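/- Units are chosen so that the gravitational constant is $1$. Bodies with masses $\mu_1,\dots,\mu_N\ge 0$ at pairwise distinct positions $q_1,\dots,q_N\in\mathbb R^3$ form a central configuration with constant $\lambda\in\mathbb R$ if the Newtonian acceleration of every body is $\lambda$ times its position, that is, $$-\sum_{j\neq i}\frac{\mu_j\,(q_i-q_j)}{|q_i-q_j|^3}=\lambda q_i\qquad (i=1,\dots,N).$$ For $n\in\mathbb N$, an integer $\ell\ge 2$, masses $m_0\ge 0$ and $m_1,\dots,m_n>0$, and radii $r=(r_1,\dots,r_n)$ with $0<r_1<\dots<r_n$, the $n\times\ell+1$ spiderweb configuration consists of a body of mass $m_0$ at the origin and, for each $i\in\{1,\dots,n\}$ and $k\in\{0,\dots,\ell-1\}$, a body of mass $m_i$ at the point $\bigl(r_i\cos\tfrac{2\pi k}{\ell},\,r_i\sin\tfrac{2\pi k}{\ell},\,0\bigr)$. **Theorem.** Let $n\in\mathbb N$, $m_0\ge 0$, $m_1,\dots,m_n>0$, and let $\lambda<0$ be fixed. 1. If $\ell\in\{2,\dots,9\}$, then there is exactly one $r=(r_1,\dots,r_n)$ with $0<r_1<\dots<r_n$ such that the $n\times\ell+1$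 spiderweb configuration is central with constant $\lambda$. 2. If $m_1\ge m_2\ge\dots\ge m_n$, then there is likewise exactly one such $r$ in each of the following cases: $\ell=10$ and $n\le 17$; $\ell=11$ and $n\le 9$; $\ell=12$ and $n\le 6$; $\ell=13$ and $n\le 5$; $\ell\in\{14,15\}$ and $n\le 4$; $\ell\in\{16,17,18\}$ and $n\le 3$. -/

import Mathlib

noncomputable section

namespace Spiderweb

open scoped BigOperators

/-- The acceleration that Newton's law of gravitation (with gravitational constant `1`)
gives to the `i`-th of finitely many bodies with masses `m` and positions `q`:
`- ∑_{j ≠ i} m_j (q_i - q_j) / |q_i - q_j| ^ 3`. -/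
def gravAccel {ι : Type*} [Fintype ι] [DecidableEq ι] (m : ι → ℝ)
    (q : ι → EuclideanSpace ℝ (Fin 3)) (i : ι) : EuclideanSpace ℝ (Fin 3) :=
  -∑ j ∈ Finset.univ.erase i, (m j / ‖q i - q j‖ ^ 3) • (q i - q j)

/-- The bodies with masses `m` and (pairwise distinct) positions `q` form a central
configuration with constant `lam`: the acceleration of every body is `lam` times its position. -/
def IsCentral {ι : Type*} [Fintype ι] [DecidableEq ι] (m : ι → ℝ)
    (q : ι → EuclideanSpace ℝ (Fin 3)) (lam : ℝ) : Prop :=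
  Function.Injective q ∧ ∀ i, gravAccel m q i = lam • q i

/-- The set of radius vectors `0 < r_1 < ... < r_n`. -/
def radii (n : ℕ) : Set (Fin n → ℝ) :=
  {r | (∀ i, 0 < r i) ∧ StrictMono r}

/-- Index set of the `n * ℓ + 1` bodies: `none` is the body at the origin, and `some (i, k)` is
the body on the `i`-th circle and the `k`-th half-line. -/
abbrev Body (n ℓ : ℕ) : Type := Option (Fin n × Fin ℓ)

/-- Masses: `m₀` at the origin, and `m i` for each of the `ℓ` bodies on the `i`-th circle. -/
def mass {n : ℕ} (ℓ : ℕ) (m₀ : ℝ) (m : Fin n → ℝ) : Body n ℓ → ℝ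
  | none => m₀
  | some (i, _) => m i

/-- Positions, in the horizontal plane of `ℝ³`: the origin, and the points at distance `r i`
from it on the half-lines at angles `2 π k / ℓ`, for `k = 0, ..., ℓ - 1`. -/
def position {n : ℕ} (ℓ : ℕ) (r : Fin n → ℝ) : Body n ℓ → EuclideanSpace ℝ (Fin 3)
  | none => 0
  | some (i, k) =>
      !₂[r i * Real.cos (2 * Real.pi * (k : ℕ) / ℓ), r i * Real.sin (2 * Real.pi * (k : ℕ) / ℓ), 0]

/-- The `n × ℓ + 1` spiderweb configuration with central mass `m₀`, masses `m` and radii `r` is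
central with constant `lam`. -/
def IsCentralSpiderweb {n : ℕ} (ℓ : ℕ) (m₀ : ℝ) (m : Fin n → ℝ) (lam : ℝ) (r : Fin n → ℝ) :
    Prop :=
  IsCentral (mass ℓ m₀ m) (position ℓ r) lam

end Spiderweb

end

noncomputable section

namespace Spiderweb

open scoped ComplexConjugate

/-! Reflection symmetry cancels the tangential part of each ring's attraction, so centrality reduces
to the `n` radial equations `residual = 0` (`isCentralSpiderweb_iff`). Up to the factor `m i`, these
say that the gradient of `energy` vanishes (`hasDerivAt_energy`).

In the coordinates `u i = log (r i)` the energy is strictly convex on the cone `u 0 < u 1 < ...`.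
The one-ring terms are positive multiples of exponentials of linear forms. For two rings, the
factorisation `1/|1 - z| = (1 - z)^(-1/2) * (1 - conj z)^(-1/2)`, summed over the `ℓ` angles, gives
a power series with nonnegative coefficients in the ratio of the radii (`hasSum_ringPotential`),
hence again a nonnegative combination of exponentials. So there is at most one critical point.

The energy blows up at collisions, at the origin and at infinity, so its sublevel sets lie in
compact subsets of the open cone, and it has a minimiser, which is critical. -/

/-- The squared distance between the points at polar coordinates `(x, 0)` and `(y, 2πk/ℓ)`. -/
def distSq (ℓ : ℕ) (x y : ℝ) (k : Fin ℓ) : ℝ :=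
  x ^ 2 + y ^ 2 - 2 * x * y * Real.cos (2 * Real.pi * (k : ℕ) / ℓ)

/-- Radial attraction on the point at distance `x` by a regular `ℓ`-gon of radius `y` with
unit masses. -/
def ringForce (ℓ : ℕ) (x y : ℝ) : ℝ :=
  ∑ k : Fin ℓ, (x - y * Real.cos (2 * Real.pi * (k : ℕ) / ℓ)) / √(distSq ℓ x y k) ^ 3

/-- Residual of the radial equation of a central configuration. -/
def residual {n : ℕ} (ℓ : ℕ) (m₀ : ℝ) (m : Fin n → ℝ) (lam : ℝ) (r : Fin n → ℝ) (i : Fin n) : ℝ :=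
  -lam * r i - m₀ / r i ^ 2 - ∑ j, m j * ringForce ℓ (r i) (r j)

/-! ### Reduction to the radial equations -/

lemma exists_angle_sub {ℓ : ℕ} [NeZero ℓ] (a b : Fin ℓ) :
    ∃ z : ℤ, 2 * Real.pi * ((a - b : Fin ℓ) : ℕ) / ℓ =
      2 * Real.pi * (a : ℕ) / ℓ - 2 * Real.pi * (b : ℕ) / ℓ + z * (2 * Real.pi) := by
  have hl : (ℓ : ℝ) ≠ 0 := by exact_mod_cast NeZero.ne ℓ
  have key : ∃ z : ℤ, (((a - b : Fin ℓ) : ℕ) : ℤ) = a - b + z * ℓ := by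
    have h : (((a - b : Fin ℓ) : ℕ)) + ℓ * ((ℓ - b + a : ℕ) / ℓ) = ℓ - b + a := by
      rw [Fin.val_sub]; exact Nat.mod_add_div _ _
    refine ⟨1 - ((ℓ - b + a : ℕ) / ℓ : ℕ), ?_⟩
    have hb := b.isLt
    zify [hb.le] at h ⊢
    linarith
  obtain ⟨z, hz⟩ := key
  have hz' : (((a - b : Fin ℓ) : ℕ) : ℝ) = a - b + z * ℓ := by exact_mod_cast hz
  refine ⟨z, ?_⟩
  rw [hz']
  field_simp

lemma cos_angle_sub {ℓ : ℕ} [NeZero ℓ] (a b : Fin ℓ) :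
    Real.cos (2 * Real.pi * ((a - b : Fin ℓ) : ℕ) / ℓ) =
      Real.cos (2 * Real.pi * (a : ℕ) / ℓ - 2 * Real.pi * (b : ℕ) / ℓ) := by
  obtain ⟨z, hz⟩ := exists_angle_sub a b
  rw [hz, Real.cos_add_int_mul_two_pi]

lemma sin_angle_sub {ℓ : ℕ} [NeZero ℓ] (a b : Fin ℓ) :
    Real.sin (2 * Real.pi * ((a - b : Fin ℓ) : ℕ) / ℓ) =
      Real.sin (2 * Real.pi * (a : ℕ) / ℓ - 2 * Real.pi * (b : ℕ) / ℓ) := by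
  obtain ⟨z, hz⟩ := exists_angle_sub a b
  rw [hz, Real.sin_add_int_mul_two_pi]

lemma cos_angle_neg {ℓ : ℕ} [NeZero ℓ] (a : Fin ℓ) :
    Real.cos (2 * Real.pi * ((-a : Fin ℓ) : ℕ) / ℓ) = Real.cos (2 * Real.pi * (a : ℕ) / ℓ) := by
  have := cos_angle_sub 0 a
  simpa using this

lemma sin_angle_neg {ℓ : ℕ} [NeZero ℓ] (a : Fin ℓ) :
    Real.sin (2 * Real.pi * ((-a : Fin ℓ) : ℕ) / ℓ) = -Real.sin (2 * Real.pi * (a : ℕ) / ℓ) := by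
  have := sin_angle_sub 0 a
  simpa using this

lemma cos_angle_lt_one {ℓ : ℕ} {k : Fin ℓ} (hk : (k : ℕ) ≠ 0) :
    Real.cos (2 * Real.pi * (k : ℕ) / ℓ) < 1 := by
  have hl : (0 : ℝ) < ℓ := by exact_mod_cast k.pos
  have hkl : ((k : ℕ) : ℝ) < ℓ := by exact_mod_cast k.isLt
  have hk0 : (0 : ℝ) < (k : ℕ) := by exact_mod_cast Nat.pos_of_ne_zero hk
  refine lt_of_le_of_ne (Real.cos_le_one _) fun h => ?_
  rw [Real.cos_eq_one_iff_of_lt_of_lt] at h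
  · have : 0 < 2 * Real.pi * (k : ℕ) / ℓ := by positivity
    exact this.ne' h
  · have : 0 < 2 * Real.pi * (k : ℕ) / ℓ := by positivity
    linarith [Real.pi_pos]
  · rw [div_lt_iff₀ hl]
    nlinarith [Real.pi_pos]

lemma distSq_pos {ℓ : ℕ} {x y : ℝ} (hx : 0 < x) (hy : 0 < y) {k : Fin ℓ}
    (h : x ≠ y ∨ (k : ℕ) ≠ 0) : 0 < distSq ℓ x y k := by
  have h1 := Real.cos_le_one (2 * Real.pi * (k : ℕ) / ℓ)
  have hxy : 0 < x * y := mul_pos hx hy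
  have e : distSq ℓ x y k =
      (x - y) ^ 2 + 2 * (x * y) * (1 - Real.cos (2 * Real.pi * (k : ℕ) / ℓ)) := by
    unfold distSq; ring
  rw [e]
  rcases h with h | h
  · have : 0 < (x - y) ^ 2 := by have := sub_ne_zero.2 h; positivity
    have : 0 ≤ 2 * (x * y) * (1 - Real.cos (2 * Real.pi * (k : ℕ) / ℓ)) :=
      mul_nonneg (by positivity) (by linarith)
    linarith
  · have := cos_angle_lt_one h
    have : 0 < 2 * (x * y) * (1 - Real.cos (2 * Real.pi * (k : ℕ) / ℓ)) :=
      mul_pos (by positivity) (by linarith)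
    nlinarith [sq_nonneg (x - y)]

lemma norm_position_sub {n ℓ : ℕ} [NeZero ℓ] (r : Fin n → ℝ) (i j : Fin n) (k k' : Fin ℓ) :
    ‖position ℓ r (some (i, k)) - position ℓ r (some (j, k'))‖ =
      √(distSq ℓ (r i) (r j) (k' - k)) := by
  rw [EuclideanSpace.norm_eq]
  congr 1
  simp only [position, distSq, cos_angle_sub, Fin.sum_univ_three, Real.norm_eq_abs, sq_abs,
    Real.cos_sub, PiLp.sub_apply]
  simp
  linear_combination (r i) ^ 2 * Real.sin_sq_add_cos_sq (2 * Real.pi * (k : ℕ) / ℓ) +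
    (r j) ^ 2 * Real.sin_sq_add_cos_sq (2 * Real.pi * (k' : ℕ) / ℓ)

lemma norm_position {n ℓ : ℕ} (r : Fin n → ℝ) (i : Fin n) (hr : 0 < r i) (k : Fin ℓ) :
    ‖position ℓ r (some (i, k))‖ = r i := by
  rw [EuclideanSpace.norm_eq, Real.sqrt_eq_iff_mul_self_eq (by positivity) hr.le]
  simp only [position, Fin.sum_univ_three, Real.norm_eq_abs, sq_abs]
  simp
  linear_combination (r i) ^ 2 * Real.sin_sq_add_cos_sq (2 * Real.pi * (k : ℕ) / ℓ)

/-- The self-term may be included: its vector is zero, whatever the value of the quotient. -/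
lemma gravAccel_eq_sum_univ {ι : Type*} [Fintype ι] [DecidableEq ι] (m : ι → ℝ)
    (q : ι → EuclideanSpace ℝ (Fin 3)) (i : ι) :
    gravAccel m q i = -∑ j, (m j / ‖q i - q j‖ ^ 3) • (q i - q j) := by
  unfold gravAccel
  rw [← Finset.sum_erase (f := fun j => (m j / ‖q i - q j‖ ^ 3) • (q i - q j)) Finset.univ (a := i)
    (by simp)]

/-- The reflection `k ↦ -k` preserves distances and flips the sine; this kills the tangential force.
-/
lemma sum_sin_div_distSq {ℓ : ℕ} [NeZero ℓ] (x y : ℝ) :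
    ∑ k : Fin ℓ, Real.sin (2 * Real.pi * (k : ℕ) / ℓ) / √(distSq ℓ x y k) ^ 3 = 0 := by
  have h := Equiv.sum_comp (Equiv.neg (Fin ℓ))
    (fun k => Real.sin (2 * Real.pi * (k : ℕ) / ℓ) / √(distSq ℓ x y k) ^ 3)
  simp only [Equiv.neg_apply, sin_angle_neg, distSq, cos_angle_neg, neg_div,
    Finset.sum_neg_distrib] at h
  simp only [distSq]
  linarith

/-- The attraction of a ring on a point of a half-line of the spiderweb is radial. -/
lemma ring_attraction {n ℓ : ℕ} [NeZero ℓ] (r : Fin n → ℝ) (i j : Fin n) (k : Fin ℓ)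
    (hr : 0 < r i) :
    ∑ k' : Fin ℓ, (1 / ‖position ℓ r (some (i, k)) - position ℓ r (some (j, k'))‖ ^ 3) •
      (position ℓ r (some (i, k)) - position ℓ r (some (j, k'))) =
      (ringForce ℓ (r i) (r j) / r i) • position ℓ r (some (i, k)) := by
  simp only [norm_position_sub]
  -- Measure angles from the attracted body, so that distances depend only on the shift `d`.
  rw [← Equiv.sum_comp (Equiv.addRight k)]
  simp only [Equiv.coe_addRight, add_sub_cancel_right]
  have hc : ∀ d : Fin ℓ, Real.cos (2 * Real.pi * ((d + k : Fin ℓ) : ℕ) / ℓ) =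
      Real.cos (2 * Real.pi * (d : ℕ) / ℓ) * Real.cos (2 * Real.pi * (k : ℕ) / ℓ) -
      Real.sin (2 * Real.pi * (d : ℕ) / ℓ) * Real.sin (2 * Real.pi * (k : ℕ) / ℓ) := fun d => by
    have := cos_angle_sub d (-k)
    rw [sub_neg_eq_add, Real.cos_sub, cos_angle_neg, sin_angle_neg] at this
    rw [this]; ring
  have hs : ∀ d : Fin ℓ, Real.sin (2 * Real.pi * ((d + k : Fin ℓ) : ℕ) / ℓ) =
      Real.sin (2 * Real.pi * (d : ℕ) / ℓ) * Real.cos (2 * Real.pi * (k : ℕ) / ℓ) +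
      Real.cos (2 * Real.pi * (d : ℕ) / ℓ) * Real.sin (2 * Real.pi * (k : ℕ) / ℓ) := fun d => by
    have := sin_angle_sub d (-k)
    rw [sub_neg_eq_add, Real.sin_sub, cos_angle_neg, sin_angle_neg] at this
    rw [this]; ring
  have h0 := sum_sin_div_distSq (ℓ := ℓ) (r i) (r j)
  have hF : ringForce ℓ (r i) (r j) = ringForce ℓ (r i) (r j) / r i * r i := by field_simp
  ext a
  fin_cases a
  · simp [position, hc, ringForce]
    simp only [ringForce] at hF
    rw [← mul_assoc, ← hF, Finset.sum_mul, ← sub_eq_zero, ← Finset.sum_sub_distrib]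
    rw [← mul_zero (r j * Real.sin (2 * Real.pi * (k : ℕ) / ℓ)), ← h0, Finset.mul_sum]
    exact Finset.sum_congr rfl fun d _ => by ring
  · simp [position, hs, ringForce]
    simp only [ringForce] at hF
    rw [← mul_assoc, ← hF, Finset.sum_mul, ← sub_eq_zero, ← Finset.sum_sub_distrib]
    rw [← mul_zero (-r j * Real.cos (2 * Real.pi * (k : ℕ) / ℓ)), ← h0, Finset.mul_sum]
    exact Finset.sum_congr rfl fun d _ => by ring
  · simp [position]

lemma gravAccel_some {n ℓ : ℕ} [NeZero ℓ] (m₀ lam : ℝ) (m r : Fin n → ℝ) (i : Fin n) (k : Fin ℓ)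
    (hr : 0 < r i) :
    gravAccel (mass ℓ m₀ m) (position ℓ r) (some (i, k)) =
      (lam + residual ℓ m₀ m lam r i / r i) • position ℓ r (some (i, k)) := by
  have h : ∀ j, ∑ k' : Fin ℓ,
      (m j / ‖position ℓ r (some (i, k)) - position ℓ r (some (j, k'))‖ ^ 3) •
      (position ℓ r (some (i, k)) - position ℓ r (some (j, k'))) =
      (m j * ringForce ℓ (r i) (r j) / r i) • position ℓ r (some (i, k)) := fun j => by
    rw [mul_div_assoc, mul_smul, ← ring_attraction r i j k hr, Finset.smul_sum]
    simp only [smul_smul, mul_one_div]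
  rw [gravAccel_eq_sum_univ, Fintype.sum_option, Fintype.sum_prod_type]
  simp only [mass, h]
  rw [← Finset.sum_smul]
  have h0 : position ℓ r none = 0 := rfl
  rw [h0, sub_zero, norm_position r i hr, ← add_smul, ← neg_smul, ← Finset.sum_div]
  congr 1
  unfold residual
  field_simp
  ring

/-- Real and imaginary parts of the vanishing sum of all powers of a primitive `ℓ`-th root of unity.
-/
lemma sum_cos_sin_angle {ℓ : ℕ} (hl : 2 ≤ ℓ) :
    ∑ k : Fin ℓ, Real.cos (2 * Real.pi * (k : ℕ) / ℓ) = 0 ∧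
    ∑ k : Fin ℓ, Real.sin (2 * Real.pi * (k : ℕ) / ℓ) = 0 := by
  have h := (Complex.isPrimitiveRoot_exp ℓ (by omega)).geom_sum_eq_zero (by omega)
  rw [← Fin.sum_univ_eq_sum_range (fun i => Complex.exp (2 * Real.pi * Complex.I / ℓ) ^ i)] at h
  have e : ∀ k : Fin ℓ, Complex.exp (2 * Real.pi * Complex.I / ℓ) ^ (k : ℕ) =
      Real.cos (2 * Real.pi * (k : ℕ) / ℓ) + Real.sin (2 * Real.pi * (k : ℕ) / ℓ) * Complex.I := by
    intro k
    rw [← Complex.exp_nat_mul, Complex.ofReal_cos, Complex.ofReal_sin, ← Complex.exp_mul_I]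
    congr 1; push_cast; ring
  simp only [e] at h
  constructor
  · simpa [-Complex.ofReal_cos, -Complex.ofReal_sin] using congrArg Complex.re h
  · simpa [-Complex.ofReal_cos, -Complex.ofReal_sin] using congrArg Complex.im h

/-- The bodies of a ring are equidistant from the origin and have their centroid there. -/
lemma gravAccel_none {n ℓ : ℕ} (hl : 2 ≤ ℓ) (m₀ : ℝ) (m r : Fin n → ℝ) (hr : ∀ i, 0 < r i) :
    gravAccel (mass ℓ m₀ m) (position ℓ r) none = 0 := by
  rw [gravAccel_eq_sum_univ, Fintype.sum_option, Fintype.sum_prod_type]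
  have h0 : position ℓ r none = 0 := rfl
  obtain ⟨hc, hs⟩ := sum_cos_sin_angle hl
  simp only [h0, sub_self, smul_zero, zero_add, zero_sub, norm_neg, norm_position r _ (hr _), mass]
  rw [Finset.sum_eq_zero, neg_zero]
  intro i _
  rw [← Finset.smul_sum, Finset.sum_neg_distrib]
  have : ∑ k : Fin ℓ, position ℓ r (some (i, k)) = 0 := by
    ext a
    fin_cases a
    · simp [position, ← Finset.mul_sum, hc]
    · simp [position, ← Finset.mul_sum, hs]
    · simp [position]
  rw [this]; simp

lemma position_injective {n ℓ : ℕ} [NeZero ℓ] {r : Fin n → ℝ} (hr : r ∈ radii n) :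
    Function.Injective (position ℓ r) := by
  have hp := hr.1
  have hne : ∀ i (k : Fin ℓ), position ℓ r (some (i, k)) ≠ 0 := fun i k h => by
    have := norm_position r i (hp i) k
    rw [h, norm_zero] at this
    exact (hp i).ne this
  rintro (_ | ⟨i, k⟩) (_ | ⟨j, k'⟩) h
  · rfl
  · exact absurd h.symm (hne _ _)
  · exact absurd h (hne _ _)
  · by_contra hcon
    have h2 := norm_position_sub r i j k k'
    rw [h, sub_self, norm_zero] at h2
    refine (Real.sqrt_pos.2 (distSq_pos (hp i) (hp j) (k := k' - k) ?_)).ne h2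
    by_contra! hc
    have h3 := hr.2.injective hc.1
    have h4 : k' - k = 0 := Fin.ext (by simpa using hc.2)
    rw [sub_eq_zero] at h4
    exact hcon (by rw [h3, h4])

/-- A spiderweb configuration is central iff the radial equations hold. -/
lemma isCentralSpiderweb_iff {n ℓ : ℕ} (hl : 2 ≤ ℓ) (m₀ lam : ℝ) (m r : Fin n → ℝ)
    (hr : r ∈ radii n) :
    IsCentralSpiderweb ℓ m₀ m lam r ↔ ∀ i, residual ℓ m₀ m lam r i = 0 := by
  have : NeZero ℓ := ⟨by omega⟩
  have hp := hr.1
  constructor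
  · rintro ⟨-, h⟩ i
    have h1 := h (some (i, 0))
    rw [gravAccel_some m₀ lam m r i 0 (hp i), add_smul, add_eq_left, smul_eq_zero] at h1
    rcases h1 with h1 | h1
    · exact (div_eq_zero_iff.1 h1).resolve_right (hp i).ne'
    · have := norm_position r i (hp i) (0 : Fin ℓ)
      rw [h1, norm_zero] at this
      exact absurd this (hp i).ne
  · intro h
    refine ⟨position_injective hr, ?_⟩
    rintro (_ | ⟨i, k⟩)
    · rw [gravAccel_none hl m₀ m r hp]
      simp [position]
    · rw [gravAccel_some m₀ lam m r i k (hp i), h i]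
      simp

/-! ### The energy and its gradient -/

/-- The potential at distance `x` on a half-line of a regular `ℓ`-gon of radius `y` with unit
masses. -/
def ringPotential (ℓ : ℕ) (x y : ℝ) : ℝ :=
  ∑ k : Fin ℓ, 1 / √(distSq ℓ x y k)

/-- The energy whose critical points are the radii of the central configurations. -/
def energy {n : ℕ} (ℓ : ℕ) (m₀ : ℝ) (m : Fin n → ℝ) (lam : ℝ) (r : Fin n → ℝ) : ℝ :=
  ∑ i, (m i * (m₀ + m i * ringForce ℓ 1 1) / r i + m i * (-lam / 2) * r i ^ 2) +
    1 / 2 * ∑ i, ∑ j, if i = j then 0 else m i * m j * ringPotential ℓ (r i) (r j)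

lemma distSq_comm (ℓ : ℕ) (x y : ℝ) (k : Fin ℓ) : distSq ℓ x y k = distSq ℓ y x k := by
  unfold distSq; ring

lemma ringPotential_comm (ℓ : ℕ) (x y : ℝ) : ringPotential ℓ x y = ringPotential ℓ y x := by
  simp only [ringPotential, distSq_comm ℓ x y]

lemma sqrt_distSq_mul (ℓ : ℕ) {c : ℝ} (hc : 0 ≤ c) (x y : ℝ) (k : Fin ℓ) :
    √(distSq ℓ (c * x) (c * y) k) = c * √(distSq ℓ x y k) := by
  have : distSq ℓ (c * x) (c * y) k = c ^ 2 * distSq ℓ x y k := by unfold distSq; ring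
  rw [this, Real.sqrt_mul (by positivity), Real.sqrt_sq hc]

/-- The force is homogeneous of degree `-2`. Its `k = 0` term is `0 / 0 = 0`, so a body does not
attract itself. -/
lemma ringForce_self (ℓ : ℕ) {x : ℝ} (hx : 0 < x) : ringForce ℓ x x = ringForce ℓ 1 1 / x ^ 2 := by
  unfold ringForce
  rw [Finset.sum_div]
  refine Finset.sum_congr rfl fun k _ => ?_
  have h := sqrt_distSq_mul ℓ hx.le 1 1 k
  rw [mul_one] at h
  rw [h, mul_pow, div_div,
    show x - x * Real.cos (2 * Real.pi * (k : ℕ) / ℓ) =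
      x * (1 - 1 * Real.cos (2 * Real.pi * (k : ℕ) / ℓ)) by ring,
    show x ^ 3 * √(distSq ℓ 1 1 k) ^ 3 = x * (√(distSq ℓ 1 1 k) ^ 3 * x ^ 2) by ring,
    mul_div_mul_left _ _ hx.ne']

lemma ringForce_one_pos {ℓ : ℕ} (hl : 2 ≤ ℓ) : 0 < ringForce ℓ 1 1 := by
  unfold ringForce
  refine Finset.sum_pos' (fun k _ => div_nonneg ?_ (by positivity)) ⟨⟨1, hl⟩, Finset.mem_univ _, ?_⟩
  · linarith [Real.cos_le_one (2 * Real.pi * (k : ℕ) / ℓ)]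
  · have h : ((⟨1, hl⟩ : Fin ℓ) : ℕ) ≠ 0 := one_ne_zero
    have h1 := cos_angle_lt_one h
    have h2 := distSq_pos one_pos one_pos (Or.inr h)
    refine div_pos (by linarith) (pow_pos (Real.sqrt_pos.2 h2) 3)

lemma hasDerivAt_ringPotential {ℓ : ℕ} {x y : ℝ → ℝ} {x' y' t : ℝ} (hx : HasDerivAt x x' t)
    (hy : HasDerivAt y y' t) (hx0 : 0 < x t) (hy0 : 0 < y t) (hxy : x t ≠ y t) :
    HasDerivAt (fun t => ringPotential ℓ (x t) (y t))
      (-(x' * ringForce ℓ (x t) (y t) + y' * ringForce ℓ (y t) (x t))) t := by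
  have h : ∀ k : Fin ℓ, HasDerivAt (fun t => 1 / √(distSq ℓ (x t) (y t) k))
      (-(x' * ((x t - y t * Real.cos (2 * Real.pi * (k : ℕ) / ℓ)) /
          √(distSq ℓ (x t) (y t) k) ^ 3) +
        y' * ((y t - x t * Real.cos (2 * Real.pi * (k : ℕ) / ℓ)) /
          √(distSq ℓ (y t) (x t) k) ^ 3))) t := fun k => by
    have hp := distSq_pos hx0 hy0 (k := k) (Or.inl hxy)
    have hd : HasDerivAt (fun t => distSq ℓ (x t) (y t) k)
        (2 * x t * x' + 2 * y t * y' -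
          2 * (x' * y t + x t * y') * Real.cos (2 * Real.pi * (k : ℕ) / ℓ)) t := by
      refine (((hx.pow 2).add (hy.pow 2)).sub
        (((hx.const_mul 2).mul hy).mul_const _)).congr_deriv ?_
      norm_num1
      ring
    have hs := (hd.sqrt hp.ne').inv (Real.sqrt_pos.2 hp).ne'
    rw [distSq_comm ℓ (y t)]
    simp only [one_div]
    refine hs.congr_deriv ?_
    have := (Real.sqrt_pos.2 hp).ne'
    field_simp
    ring
  unfold ringPotential ringForce
  refine (HasDerivAt.fun_sum fun k _ => h k).congr_deriv ?_
  rw [Finset.mul_sum, Finset.mul_sum, ← Finset.sum_add_distrib, Finset.sum_neg_distrib]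

/-- Stated along a curve, to serve both coordinate lines (criticality of the minimiser) and
geometric interpolations (uniqueness). -/
lemma hasDerivAt_energy {n : ℕ} (ℓ : ℕ) (m₀ : ℝ) (m : Fin n → ℝ) (lam : ℝ) {r : ℝ → Fin n → ℝ}
    {r' : Fin n → ℝ} {t : ℝ} (hr : ∀ i, HasDerivAt (fun s => r s i) (r' i) t)
    (ht : r t ∈ radii n) :
    HasDerivAt (fun s => energy ℓ m₀ m lam (r s))
      (∑ i, r' i * m i * residual ℓ m₀ m lam (r t) i) t := by
  have hp := ht.1
  have h1 : ∀ i, HasDerivAt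
      (fun s => m i * (m₀ + m i * ringForce ℓ 1 1) / r s i + m i * (-lam / 2) * r s i ^ 2)
      (r' i * m i * (-lam * r t i - m₀ / r t i ^ 2 - m i * ringForce ℓ (r t i) (r t i))) t := by
    intro i
    rw [ringForce_self ℓ (hp i)]
    simp only [div_eq_mul_inv (m i * (m₀ + m i * ringForce ℓ 1 1))]
    refine ((((hr i).inv (hp i).ne').const_mul _).add (((hr i).pow 2).const_mul _)).congr_deriv ?_
    have := (hp i).ne'
    field_simp
    simp
    ring
  have h2 : ∀ i j, HasDerivAt
      (fun s => if i = j then 0 else m i * m j * ringPotential ℓ (r s i) (r s j))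
      (if i = j then 0 else -(r' i * m i * (m j * ringForce ℓ (r t i) (r t j)) +
        r' j * m j * (m i * ringForce ℓ (r t j) (r t i)))) t := by
    intro i j
    split_ifs with hij
    · exact hasDerivAt_const _ _
    · refine ((hasDerivAt_ringPotential (hr i) (hr j) (hp i) (hp j)
        (fun h => hij (ht.2.injective h))).const_mul (m i * m j)).congr_deriv ?_
      ring
  unfold energy
  refine ((HasDerivAt.fun_sum fun i _ => h1 i).add ((HasDerivAt.fun_sum fun i _ =>
    HasDerivAt.fun_sum fun j _ => h2 i j).const_mul (1 / 2))).congr_deriv ?_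
  -- Exchanging `i` and `j` identifies the two halves of the double sum; the factor 2 cancels the `1
  -- / 2` in `energy`.
  have e : ∑ i, ∑ j, (if i = j then 0 else -(r' i * m i * (m j * ringForce ℓ (r t i) (r t j)) +
        r' j * m j * (m i * ringForce ℓ (r t j) (r t i)))) =
      -2 * ∑ i, ∑ j, if i = j then 0 else r' i * m i * (m j * ringForce ℓ (r t i) (r t j)) := by
    have hsym : ∑ i, ∑ j, (if i = j then 0 else r' i * m i * (m j * ringForce ℓ (r t i) (r t j))) =
        ∑ i, ∑ j, if i = j then 0 else r' j * m j * (m i * ringForce ℓ (r t j) (r t i)) := by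
      rw [Finset.sum_comm]
      simp only [eq_comm]
    rw [neg_mul, two_mul]
    nth_rw 2 [hsym]
    simp only [← Finset.sum_add_distrib, ← Finset.sum_neg_distrib]
    refine Finset.sum_congr rfl fun i _ => Finset.sum_congr rfl fun j _ => ?_
    split_ifs <;> ring
  rw [e, ← mul_assoc, show (1 / 2 : ℝ) * -2 = -1 by norm_num, neg_one_mul, ← sub_eq_add_neg,
    ← Finset.sum_sub_distrib]
  refine Finset.sum_congr rfl fun i _ => ?_
  unfold residual
  rw [← Finset.add_sum_erase _ (fun j => m j * ringForce ℓ (r t i) (r t j)) (Finset.mem_univ i),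
    ← Finset.add_sum_erase _ (fun j => if i = j then (0 : ℝ) else _) (Finset.mem_univ i)]
  rw [if_pos rfl, Finset.sum_congr rfl (fun j hj => if_neg (Finset.ne_of_mem_erase hj).symm),
    ← Finset.mul_sum]
  ring

/-! ### Nonnegative series for the ring potential -/

/-- The Taylor coefficients of `(1 - z) ^ (-1 / 2)`. -/
def invSqrtCoeff (p : ℕ) : ℝ := Ring.choose ((1 / 2 : ℝ) + p - 1) p

/-- Multiplied by `p!`, the coefficient is the rising factorial of `1 / 2`, which is positive. -/
lemma invSqrtCoeff_nonneg (p : ℕ) : 0 ≤ invSqrtCoeff p := by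
  have h := Ring.factorial_nsmul_multichoose_eq_ascPochhammer (1 / 2 : ℝ) p
  rw [Ring.multichoose_eq, ← invSqrtCoeff] at h
  have h2 : 0 < (ascPochhammer ℕ p).smeval (1 / 2 : ℝ) := by
    have := ascPochhammer_pos p (1 / 2 : ℝ) (by norm_num)
    rwa [Polynomial.ascPochhammer_smeval_eq_eval]
  rw [← h, nsmul_eq_mul] at h2
  exact (pos_of_mul_pos_right h2 (by positivity)).le

lemma hasSum_invSqrt {z : ℂ} (hz : ‖z‖ < 1) :
    HasSum (fun p => (invSqrtCoeff p : ℂ) * z ^ p) (1 / (1 - z) ^ (1 / 2 : ℂ)) := by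
  have h := (Complex.one_div_one_sub_cpow_hasFPowerSeriesOnBall_zero (1 / 2)).hasSum (y := z)
    (by simpa [Metric.mem_eball, edist_eq_enorm_sub, ← ofReal_norm] using hz)
  simp only [zero_add] at h
  refine (congrArg (HasSum · _) (funext fun p => ?_)).mp h
  rw [FormalMultilinearSeries.ofScalars_apply_eq, smul_eq_mul, invSqrtCoeff, Complex.ofReal_choose]
  push_cast
  rfl

lemma summable_norm_invSqrt {z : ℂ} (hz : ‖z‖ < 1) :
    Summable (fun p => ‖(invSqrtCoeff p : ℂ) * z ^ p‖) := by
  have h := (hasSum_invSqrt (z := (‖z‖ : ℂ)) (by simpa using hz)).summable.norm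
  simpa using h

/-- Since `1 - z` lies in the right half-plane, off the branch cut, the principal square root
commutes with conjugation. -/
lemma inv_sqrt_mul_conj {z : ℂ} (hz : ‖z‖ < 1) :
    1 / (1 - z) ^ (1 / 2 : ℂ) * (1 / (1 - conj z) ^ (1 / 2 : ℂ)) = ((1 / ‖1 - z‖ : ℝ) : ℂ) := by
  have hre : 0 < (1 - z).re := by
    have := (Complex.re_le_norm z).trans_lt hz
    rw [Complex.sub_re, Complex.one_re]
    linarith
  have hcj : (1 - conj z) ^ (1 / 2 : ℂ) = conj ((1 - z) ^ (1 / 2 : ℂ)) := by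
    have harg : (1 - z).arg ≠ Real.pi := fun h0 => by
      rw [Complex.arg_eq_pi_iff] at h0; linarith [h0.1]
    have := Complex.conj_cpow (1 - z) (1 / 2) harg
    simp only [map_sub, map_one, map_div₀, map_ofNat] at this
    rw [this]
  have hnorm : ‖(1 - z) ^ (1 / 2 : ℂ)‖ = ‖1 - z‖ ^ (1 / 2 : ℝ) := by
    have := Complex.norm_cpow_real (1 - z) (1 / 2)
    simpa using this
  have hsq : ‖(1 - z) ^ (1 / 2 : ℂ)‖ ^ 2 = ‖1 - z‖ := by
    rw [hnorm, ← Real.sqrt_eq_rpow, Real.sq_sqrt (norm_nonneg _)]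
  rw [hcj, div_mul_div_comm, one_mul, Complex.mul_conj, Complex.normSq_eq_norm_sq, hsq,
    Complex.ofReal_div, Complex.ofReal_one]

lemma hasSum_inv_norm_one_sub {z : ℂ} (hz : ‖z‖ < 1) :
    HasSum (fun pq : ℕ × ℕ => ((invSqrtCoeff pq.1 : ℂ) * z ^ pq.1) *
      ((invSqrtCoeff pq.2 : ℂ) * (conj z) ^ pq.2)) ((1 / ‖1 - z‖ : ℝ) : ℂ) := by
  have hz' : ‖conj z‖ < 1 := by rwa [RCLike.norm_conj]
  have hs := summable_mul_of_summable_norm (summable_norm_invSqrt hz) (summable_norm_invSqrt hz')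
  have h := HasSum.mul (hasSum_invSqrt hz) (hasSum_invSqrt hz') hs
  rwa [inv_sqrt_mul_conj hz] at h

/-- Power sums over the `ℓ`-th roots of unity. -/
def rootSum (ℓ p q : ℕ) : ℝ := ∑ k : Fin ℓ, Real.cos ((p - q) * (2 * Real.pi * (k : ℕ) / ℓ))

/-- A geometric sum of an `ℓ`-th root of unity `w` is `ℓ` if `w = 1` and `0` otherwise. -/
lemma rootSum_nonneg (ℓ p q : ℕ) : 0 ≤ rootSum ℓ p q := by
  set w : ℂ := Complex.exp (((p - q) * (2 * Real.pi / ℓ) : ℝ) * Complex.I) with hw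
  have e : rootSum ℓ p q = (∑ k ∈ Finset.range ℓ, w ^ k).re := by
    rw [← Fin.sum_univ_eq_sum_range (fun k => w ^ k), Complex.re_sum]
    refine Finset.sum_congr rfl fun k _ => ?_
    rw [hw, ← Complex.exp_nat_mul, ← mul_assoc, ← Complex.ofReal_natCast, ← Complex.ofReal_mul,
      Complex.exp_ofReal_mul_I_re]
    congr 1; ring
  rw [e]
  by_cases h1 : w = 1
  · simp [h1]
  · rcases Nat.eq_zero_or_pos ℓ with h0 | h0
    · simp [h0]
    have hwl : w ^ ℓ = 1 := by
      rw [hw, ← Complex.exp_nat_mul, Complex.exp_eq_one_iff]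
      refine ⟨p - q, ?_⟩
      have : (ℓ : ℂ) ≠ 0 := by exact_mod_cast h0.ne'
      push_cast
      field_simp
    rw [geom_sum_eq h1, hwl]
    simp

/-- Put `z = x * exp (iθ)` in the double series: the `(p, q)` term carries the phase `(p - q)θ`, and
summing its cosine over the ring gives `rootSum`. -/
lemma hasSum_ringPotential (ℓ : ℕ) {x : ℝ} (hx : 0 ≤ x) (hx1 : x < 1) :
    HasSum (fun pq : ℕ × ℕ => invSqrtCoeff pq.1 * invSqrtCoeff pq.2 * rootSum ℓ pq.1 pq.2 *
      x ^ (pq.1 + pq.2)) (ringPotential ℓ x 1) := by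
  have h : ∀ k : Fin ℓ, HasSum (fun pq : ℕ × ℕ => invSqrtCoeff pq.1 * invSqrtCoeff pq.2 *
      Real.cos ((pq.1 - pq.2) * (2 * Real.pi * (k : ℕ) / ℓ)) * x ^ (pq.1 + pq.2))
      (1 / √(distSq ℓ x 1 k)) := fun k => by
    set θ : ℝ := 2 * Real.pi * (k : ℕ) / ℓ with hθ
    have hz : ‖(x : ℂ) * Complex.exp (θ * Complex.I)‖ < 1 := by
      rw [norm_mul, Complex.norm_exp_ofReal_mul_I, mul_one, Complex.norm_real,
        Real.norm_of_nonneg hx]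
      exact hx1
    have h1 := Complex.hasSum_re (hasSum_inv_norm_one_sub hz)
    rw [Complex.ofReal_re] at h1
    convert h1 using 1
    · ext pq
      have : ((invSqrtCoeff pq.1 : ℂ) * ((x : ℂ) * Complex.exp (θ * Complex.I)) ^ pq.1) *
          ((invSqrtCoeff pq.2 : ℂ) * (conj ((x : ℂ) * Complex.exp (θ * Complex.I))) ^ pq.2) =
          ((invSqrtCoeff pq.1 * invSqrtCoeff pq.2 * x ^ (pq.1 + pq.2) : ℝ) : ℂ) *
            Complex.exp (((pq.1 - pq.2) * θ : ℝ) * Complex.I) := by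
        rw [map_mul, Complex.conj_ofReal, ← Complex.exp_conj, map_mul, Complex.conj_ofReal,
          Complex.conj_I, mul_pow, mul_pow, ← Complex.exp_nat_mul, ← Complex.exp_nat_mul]
        have : Complex.exp (((pq.1 - pq.2) * θ : ℝ) * Complex.I) =
            Complex.exp (pq.1 * (θ * Complex.I)) * Complex.exp (pq.2 * (θ * -Complex.I)) := by
          rw [← Complex.exp_add]; congr 1; push_cast; ring
        rw [this]; push_cast; ring
      rw [this, Complex.re_ofReal_mul, Complex.exp_ofReal_mul_I_re]
      ring
    · congr 1
      rw [Complex.norm_eq_sqrt_sq_add_sq]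
      congr 1
      simp only [Complex.sub_re, Complex.sub_im, Complex.one_re, Complex.one_im,
        Complex.re_ofReal_mul, Complex.im_ofReal_mul, Complex.exp_ofReal_mul_I_re,
        Complex.exp_ofReal_mul_I_im, distSq, ← hθ]
      linear_combination -x ^ 2 * Real.sin_sq_add_cos_sq θ
  unfold ringPotential rootSum
  refine (congrArg (HasSum · _) (funext fun pq => ?_)).mp (hasSum_sum fun k _ => h k)
  rw [Finset.mul_sum, Finset.sum_mul]

/-- Homogeneity of degree `-1` scales the outer radius to 1; each term is then an exponential of a
linear form in `(a, b)`. -/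
lemma hasSum_ringPotential_exp (ℓ : ℕ) {a b : ℝ} (h : a < b) :
    HasSum (fun pq : ℕ × ℕ => invSqrtCoeff pq.1 * invSqrtCoeff pq.2 * rootSum ℓ pq.1 pq.2 *
      Real.exp ((pq.1 + pq.2) * a - (pq.1 + pq.2 + 1) * b))
      (ringPotential ℓ (Real.exp a) (Real.exp b)) := by
  have h1 := (hasSum_ringPotential ℓ (Real.exp_pos (a - b)).le
    (Real.exp_lt_one_iff.2 (by linarith))).mul_left (Real.exp (-b))
  have e : Real.exp (-b) * ringPotential ℓ (Real.exp (a - b)) 1 =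
      ringPotential ℓ (Real.exp a) (Real.exp b) := by
    unfold ringPotential
    rw [Finset.mul_sum]
    refine Finset.sum_congr rfl fun k _ => ?_
    have := sqrt_distSq_mul ℓ (Real.exp_pos b).le (Real.exp (a - b)) 1 k
    rw [← Real.exp_add, add_sub_cancel, mul_one] at this
    rw [this, Real.exp_neg]
    field_simp
  rw [e] at h1
  refine (congrArg (HasSum · _) (funext fun pq => ?_)).mp h1
  rw [← Real.exp_nat_mul, mul_left_comm, ← Real.exp_add]
  congr 2
  push_cast; ring

/-! ### Convexity in logarithmic coordinates -/

lemma convexOn_of_hasSum {ι : Type*} {S : Set ℝ} (hS : Convex ℝ S) {f : ι → ℝ → ℝ} {F : ℝ → ℝ}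
    (hf : ∀ i, ConvexOn ℝ S (f i)) (hF : ∀ t ∈ S, HasSum (fun i => f i t) (F t)) :
    ConvexOn ℝ S F := by
  refine ⟨hS, fun x hx y hy a b ha hb hab => ?_⟩
  exact hasSum_le (fun i => (hf i).2 hx hy ha hb hab) (hF _ (hS hx hy ha hb hab))
    (((hF x hx).const_smul a).add ((hF y hy).const_smul b))

lemma convexOn_exp_affine (c d : ℝ) {S : Set ℝ} (hS : Convex ℝ S) :
    ConvexOn ℝ S (fun t => Real.exp (c + t * d)) := by
  refine ⟨hS, fun x _ y _ a b ha hb hab => ?_⟩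
  have := convexOn_exp.2 (Set.mem_univ (c + x * d)) (Set.mem_univ (c + y * d)) ha hb hab
  convert this using 2
  simp only [smul_eq_mul]
  linear_combination (-c) * hab

lemma convexOn_ringPotential_exp (ℓ : ℕ) {S : Set ℝ} (hS : Convex ℝ S) (a a' b b' : ℝ)
    (h : ∀ t ∈ S, a + t * a' < b + t * b') :
    ConvexOn ℝ S (fun t => ringPotential ℓ (Real.exp (a + t * a')) (Real.exp (b + t * b'))) := by
  refine convexOn_of_hasSum hS (fun pq => ?_) (fun t ht => hasSum_ringPotential_exp ℓ (h t ht))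
  have := (convexOn_exp_affine ((pq.1 + pq.2) * a - (pq.1 + pq.2 + 1) * b)
    ((pq.1 + pq.2) * a' - (pq.1 + pq.2 + 1) * b') hS).smul
    (mul_nonneg (mul_nonneg (invSqrtCoeff_nonneg pq.1) (invSqrtCoeff_nonneg pq.2))
      (rootSum_nonneg ℓ pq.1 pq.2))
  refine this.congr fun t _ => ?_
  simp only [smul_eq_mul]
  congr 2
  ring

/-! ### Existence: coercivity and the minimiser -/

lemma isOpen_radii (n : ℕ) : IsOpen (radii n) := by
  have : radii n = (⋂ i, {r | 0 < r i}) ∩ ⋂ i, ⋂ j, ⋂ _ : i < j, {r | r i < r j} := by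
    ext r; simp [radii, StrictMono]
  rw [this]
  refine (isOpen_iInter_of_finite fun i => isOpen_lt continuous_const (continuous_apply i)).inter ?_
  exact isOpen_iInter_of_finite fun i => isOpen_iInter_of_finite fun j =>
    isOpen_iInter_of_finite fun _ => isOpen_lt (continuous_apply i) (continuous_apply j)

lemma continuousOn_energy {n : ℕ} (ℓ : ℕ) (m₀ : ℝ) (m : Fin n → ℝ) (lam : ℝ) :
    ContinuousOn (energy ℓ m₀ m lam) (radii n) := by
  have hc : ∀ i, ContinuousOn (fun r : Fin n → ℝ => r i) (radii n) := fun i =>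
    (continuous_apply i).continuousOn
  unfold energy
  refine (continuousOn_finsetSum _ fun i _ => ?_).add
    (continuousOn_const.mul (continuousOn_finsetSum _ fun i _ => continuousOn_finsetSum _ fun j _ => ?_))
  · exact (continuousOn_const.div (hc i) fun r hr => (hr.1 i).ne').add
      (continuousOn_const.mul ((hc i).pow 2))
  · by_cases hij : i = j
    · simp only [hij, if_true]; exact continuousOn_const
    · simp only [hij, if_false]
      refine continuousOn_const.mul (continuousOn_finsetSum _ fun k _ => ?_)
      refine continuousOn_const.div (Continuous.continuousOn ?_) fun r hr => ?_
      · unfold distSq; fun_prop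
      · exact (Real.sqrt_pos.2 (distSq_pos (hr.1 i) (hr.1 j)
          (Or.inl fun h => hij (hr.2.injective h)))).ne'

lemma ringPotential_nonneg (ℓ : ℕ) (x y : ℝ) : 0 ≤ ringPotential ℓ x y :=
  Finset.sum_nonneg fun _ _ => by positivity

/-- The `k = 0` term alone, from bodies on a common half-line, forces blow-up when two rings meet.
-/
lemma inv_sub_le_ringPotential {ℓ : ℕ} (hl : 2 ≤ ℓ) {x y : ℝ} (h : x < y) :
    1 / (y - x) ≤ ringPotential ℓ x y := by
  have h0 : 1 / √(distSq ℓ x y ⟨0, by omega⟩) = 1 / (y - x) := by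
    have : distSq ℓ x y ⟨0, by omega⟩ = (y - x) ^ 2 := by simp [distSq]; ring
    rw [this, Real.sqrt_sq (by linarith)]
  rw [← h0]
  exact Finset.single_le_sum (f := fun k => 1 / √(distSq ℓ x y k)) (fun k _ => by positivity)
    (Finset.mem_univ _)

section Bounds

variable {n ℓ : ℕ} {m₀ : ℝ} {m : Fin n → ℝ} {lam : ℝ}

lemma ring_energy_nonneg (hl : 2 ≤ ℓ) (hm₀ : 0 ≤ m₀) (hm : ∀ i, 0 < m i) (hlam : lam < 0)
    {r : Fin n → ℝ} (hr : r ∈ radii n) (i : Fin n) :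
    0 ≤ m i * (m₀ + m i * ringForce ℓ 1 1) / r i ∧ 0 ≤ m i * (-lam / 2) * r i ^ 2 := by
  have h1 := hm i
  have h2 := hr.1 i
  have h3 := ringForce_one_pos hl
  have h4 : 0 < -lam := by linarith
  constructor <;> positivity

lemma pair_energy_nonneg (hm : ∀ i, 0 < m i) (r : Fin n → ℝ) (i j : Fin n) :
    0 ≤ if i = j then 0 else m i * m j * ringPotential ℓ (r i) (r j) := by
  split_ifs
  · exact le_rfl
  · exact mul_nonneg (mul_pos (hm i) (hm j)).le (ringPotential_nonneg _ _ _)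

lemma ring_energy_le (hl : 2 ≤ ℓ) (hm₀ : 0 ≤ m₀) (hm : ∀ i, 0 < m i) (hlam : lam < 0)
    {r : Fin n → ℝ} (hr : r ∈ radii n) (i : Fin n) :
    m i * (m₀ + m i * ringForce ℓ 1 1) / r i + m i * (-lam / 2) * r i ^ 2 ≤
      energy ℓ m₀ m lam r := by
  have h1 := Finset.single_le_sum
    (f := fun i => m i * (m₀ + m i * ringForce ℓ 1 1) / r i + m i * (-lam / 2) * r i ^ 2)
    (fun i _ => add_nonneg (ring_energy_nonneg hl hm₀ hm hlam hr i).1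
      (ring_energy_nonneg hl hm₀ hm hlam hr i).2) (Finset.mem_univ i)
  have h2 : 0 ≤ ∑ i, ∑ j, if i = j then 0 else m i * m j * ringPotential ℓ (r i) (r j) :=
    Finset.sum_nonneg fun i _ => Finset.sum_nonneg fun j _ => pair_energy_nonneg hm r i j
  unfold energy
  linarith

lemma pair_energy_le (hl : 2 ≤ ℓ) (hm₀ : 0 ≤ m₀) (hm : ∀ i, 0 < m i) (hlam : lam < 0)
    {r : Fin n → ℝ} (hr : r ∈ radii n) {i j : Fin n} (hij : i < j) :
    m i * m j / 2 / (r j - r i) ≤ energy ℓ m₀ m lam r := by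
  have h1 : 0 ≤ ∑ i, (m i * (m₀ + m i * ringForce ℓ 1 1) / r i + m i * (-lam / 2) * r i ^ 2) :=
    Finset.sum_nonneg fun i _ => add_nonneg (ring_energy_nonneg hl hm₀ hm hlam hr i).1
      (ring_energy_nonneg hl hm₀ hm hlam hr i).2
  have h2 := Finset.single_le_sum
    (f := fun j => if i = j then 0 else m i * m j * ringPotential ℓ (r i) (r j))
    (fun j _ => pair_energy_nonneg hm r i j) (Finset.mem_univ j)
  have h3 := Finset.single_le_sum
    (f := fun i => ∑ j, if i = j then 0 else m i * m j * ringPotential ℓ (r i) (r j))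
    (fun i _ => Finset.sum_nonneg fun j _ => pair_energy_nonneg hm r i j) (Finset.mem_univ i)
  have h4 := mul_le_mul_of_nonneg_left (inv_sub_le_ringPotential hl (hr.2 hij))
    (mul_pos (hm i) (hm j)).le
  have h5 : m i * m j / 2 / (r j - r i) = 1 / 2 * (m i * m j * (1 / (r j - r i))) := by ring
  simp only [hij.ne, if_false] at h2
  unfold energy
  linarith

lemma exists_isMinOn_energy (hl : 2 ≤ ℓ) (hm₀ : 0 ≤ m₀) (hm : ∀ i, 0 < m i) (hlam : lam < 0) :
    ∃ r ∈ radii n, IsMinOn (energy ℓ m₀ m lam) (radii n) r := by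
  have hζ := ringForce_one_pos hl
  obtain ⟨r₀, hr₀⟩ : ∃ r₀, r₀ ∈ radii n :=
    ⟨fun i => (i : ℕ) + 1, fun i => by positivity, fun i j h => by simpa using h⟩
  set C := energy ℓ m₀ m lam r₀ with hC
  have hC0 : 0 ≤ C := by
    rw [hC]; unfold energy
    exact add_nonneg (Finset.sum_nonneg fun i _ =>
      add_nonneg (ring_energy_nonneg hl hm₀ hm hlam hr₀ i).1
        (ring_energy_nonneg hl hm₀ hm hlam hr₀ i).2)
      (mul_nonneg (by norm_num) (Finset.sum_nonneg fun i _ => Finset.sum_nonneg fun j _ =>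
        pair_energy_nonneg hm r₀ i j))
  -- `C` may be zero (when `n = 0`); `C + 1` is a safe divisor.
  have hC1 : 0 < C + 1 := by linarith
  -- On the sublevel set, the `1 / r i` terms bound the radii below by `a`, the quadratic terms
  -- bound them above by `b`, and the pair terms keep gaps of at least `d`. The `+ 1` in `b` lets a
  -- bound on `r i ^ 2` bound `r i` without a square root.
  let a : Fin n → ℝ := fun i => m i * (m₀ + m i * ringForce ℓ 1 1) / (C + 1)
  let b : Fin n → ℝ := fun i => C / (m i * (-lam / 2)) + 1
  let d : Fin n → Fin n → ℝ := fun i j => m i * m j / 2 / (C + 1)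
  have ha : ∀ i, 0 < a i := fun i => by have := hm i; positivity
  have hd : ∀ i j, 0 < d i j := fun i j => by have := hm i; have := hm j; positivity
  let K : Set (Fin n → ℝ) := Set.Icc a b ∩ ⋂ i, ⋂ j, ⋂ _ : i < j, {r | d i j ≤ r j - r i}
  have hK : IsCompact K := isCompact_Icc.inter_right <| isClosed_iInter fun i =>
    isClosed_iInter fun j => isClosed_iInter fun _ =>
      isClosed_le continuous_const ((continuous_apply j).sub (continuous_apply i))
  have hKr : K ⊆ radii n := fun r hr => by
    refine ⟨fun i => (ha i).trans_le (hr.1.1 i), fun i j hij => ?_⟩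
    have h := hr.2
    simp only [Set.mem_iInter, Set.mem_ofPred_eq] at h
    linarith [h i j hij, hd i j]
  have hsub : ∀ r ∈ radii n, energy ℓ m₀ m lam r ≤ C → r ∈ K := fun r hr hrC => by
    refine ⟨⟨fun i => ?_, fun i => ?_⟩, ?_⟩
    · have h1 := ring_energy_le hl hm₀ hm hlam hr i
      have h2 := (ring_energy_nonneg hl hm₀ hm hlam hr i).2
      have h3 : m i * (m₀ + m i * ringForce ℓ 1 1) / r i ≤ C + 1 := by linarith
      exact (div_le_comm₀ (hr.1 i) hC1).1 h3
    · have h1 := ring_energy_le hl hm₀ hm hlam hr i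
      have h2 := (ring_energy_nonneg hl hm₀ hm hlam hr i).1
      have h4 : 0 < m i * (-lam / 2) := mul_pos (hm i) (by linarith)
      have h3 : r i ^ 2 ≤ C / (m i * (-lam / 2)) := by
        rw [le_div_iff₀ h4]; linarith
      change r i ≤ C / (m i * (-lam / 2)) + 1
      nlinarith [sq_nonneg (r i - 1), hr.1 i]
    · simp only [Set.mem_iInter, Set.mem_ofPred_eq]
      intro i j hij
      have h1 := (pair_energy_le hl hm₀ hm hlam hr hij).trans (hrC.trans (by linarith : C ≤ C + 1))
      exact (div_le_comm₀ (sub_pos.2 (hr.2 hij)) hC1).1 h1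
  obtain ⟨r, hrK, hmin⟩ := hK.exists_isMinOn ⟨r₀, hsub r₀ hr₀ le_rfl⟩
    ((continuousOn_energy ℓ m₀ m lam).mono hKr)
  refine ⟨r, hKr hrK, fun s hs => ?_⟩
  rcases le_or_gt (energy ℓ m₀ m lam s) C with h | h
  · exact hmin (hsub s hs h)
  · exact (hmin (hsub r₀ hr₀ le_rfl)).trans h.le

lemma residual_eq_zero_of_isMinOn (hm : ∀ i, 0 < m i) {r : Fin n → ℝ} (hr : r ∈ radii n)
    (hmin : IsMinOn (energy ℓ m₀ m lam) (radii n) r) (i : Fin n) :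
    residual ℓ m₀ m lam r i = 0 := by
  let c : ℝ → Fin n → ℝ := fun s j => r j + s * (if j = i then 1 else 0)
  have hc0 : c 0 = r := by ext j; simp [c]
  have hcont : Continuous c := by fun_prop
  have hd : ∀ j, HasDerivAt (fun s => c s j) (if j = i then 1 else 0) 0 := fun j => by
    refine (((hasDerivAt_id (0 : ℝ)).mul_const
      (if j = i then (1 : ℝ) else 0)).const_add (r j)).congr_deriv (one_mul _)
  have hD := hasDerivAt_energy ℓ m₀ m lam hd (by rwa [hc0])
  have hloc : IsLocalMin (fun s => energy ℓ m₀ m lam (c s)) 0 := by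
    have h1 : ∀ᶠ s in nhds (0 : ℝ), c s ∈ radii n :=
      hcont.continuousAt.eventually_mem ((isOpen_radii n).mem_nhds (by rwa [hc0]))
    filter_upwards [h1] with s hs
    rw [hc0]
    exact hmin hs
  have h := hloc.hasDerivAt_eq_zero hD
  rw [hc0] at h
  simp only [ite_mul, one_mul, zero_mul, Finset.sum_ite_eq', Finset.mem_univ, if_true] at h
  exact (mul_eq_zero.1 h).resolve_left (hm i).ne'

end Bounds

/-! ### Uniqueness by strict convexity -/

section Uniqueness

variable {n ℓ : ℕ} {m₀ : ℝ} {m : Fin n → ℝ} {lam : ℝ}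

/-- The energy is strictly convex along geometric interpolations between radius vectors. -/
lemma strictConvexOn_energy_exp (hl : 2 ≤ ℓ) (hm₀ : 0 ≤ m₀) (hm : ∀ i, 0 < m i) (hlam : lam < 0)
    {S : Set ℝ} (hS : Convex ℝ S) {a a' : Fin n → ℝ}
    (h : ∀ t ∈ S, StrictMono fun i => a i + t * a' i) (ha : a' ≠ 0) :
    StrictConvexOn ℝ S (fun t => energy ℓ m₀ m lam fun i => Real.exp (a i + t * a' i)) := by
  have hζ := ringForce_one_pos hl
  have h1 : ConvexOn ℝ S
      (fun t => ∑ i, m i * (m₀ + m i * ringForce ℓ 1 1) / Real.exp (a i + t * a' i)) := by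
    refine convexOn_of_hasSum hS (fun i => ?_) fun t _ => hasSum_fintype _
    have := (convexOn_exp_affine (-a i) (-a' i) hS).smul
      (show 0 ≤ m i * (m₀ + m i * ringForce ℓ 1 1) by have := hm i; positivity)
    refine this.congr fun t _ => ?_
    simp only [smul_eq_mul, div_eq_mul_inv, ← Real.exp_neg]
    congr 2
    ring
  have h2 : ConvexOn ℝ S (fun t => 1 / 2 * ∑ i, ∑ j, if i = j then 0 else
      m i * m j * ringPotential ℓ (Real.exp (a i + t * a' i)) (Real.exp (a j + t * a' j))) := by
    refine ConvexOn.smul (c := (1 / 2 : ℝ)) (by norm_num) ?_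
    refine convexOn_of_hasSum hS (fun i => ?_) fun t _ => hasSum_fintype _
    refine convexOn_of_hasSum hS (fun j => ?_) fun t _ => hasSum_fintype _
    rcases lt_trichotomy i j with hij | hij | hij
    · simp only [hij.ne, if_false]
      exact (convexOn_ringPotential_exp ℓ hS _ _ _ _ fun t ht => h t ht hij).smul
        (mul_pos (hm i) (hm j)).le
    · simp only [hij, if_true]; exact convexOn_const 0 hS
    · simp only [hij.ne', if_false]
      -- The series needs the inner radius as first argument.
      simp only [ringPotential_comm ℓ (Real.exp (a i + _ * a' i))]
      exact (convexOn_ringPotential_exp ℓ hS _ _ _ _ fun t ht => h t ht hij).smul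
        (mul_pos (hm i) (hm j)).le
  -- Strictness comes from the quadratic terms alone: `-lam / 2 > 0`, and some `a' i` is nonzero.
  have h3 : StrictConvexOn ℝ S
      (fun t => ∑ i, m i * (-lam / 2) * Real.exp (a i + t * a' i) ^ 2) := by
    refine ⟨hS, fun x hx y hy hxy p q hp hq hpq => ?_⟩
    simp only [smul_eq_mul, Finset.mul_sum, ← Finset.sum_add_distrib]
    have hc : ∀ i, 0 < m i * (-lam / 2) := fun i => mul_pos (hm i) (by linarith)
    have key : ∀ i t, Real.exp (a i + t * a' i) ^ 2 = Real.exp (2 * (a i + t * a' i)) :=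
      fun i t => by rw [← Real.exp_nat_mul]; norm_num
    have e : ∀ i, 2 * (a i + (p * x + q * y) * a' i) =
        p * (2 * (a i + x * a' i)) + q * (2 * (a i + y * a' i)) := fun i => by
      linear_combination (-2 * a i) * hpq
    simp only [key, e]
    obtain ⟨i, hi⟩ := Function.ne_iff.1 ha
    refine Finset.sum_lt_sum (fun i _ => ?_) ⟨i, Finset.mem_univ _, ?_⟩
    · have := convexOn_exp.2 (Set.mem_univ (2 * (a i + x * a' i)))
        (Set.mem_univ (2 * (a i + y * a' i))) hp.le hq.le hpq
      simp only [smul_eq_mul] at this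
      nlinarith [mul_le_mul_of_nonneg_left this (hc i).le]
    · have hne : 2 * (a i + x * a' i) ≠ 2 * (a i + y * a' i) := fun h0 => hxy <| by
        have : (x - y) * a' i = 0 := by linarith
        exact sub_eq_zero.1 ((mul_eq_zero.1 this).resolve_right hi)
      have := strictConvexOn_exp.2 (Set.mem_univ (2 * (a i + x * a' i)))
        (Set.mem_univ (2 * (a i + y * a' i))) hne hp hq hpq
      simp only [smul_eq_mul] at this
      nlinarith [mul_lt_mul_of_pos_left this (hc i)]
  refine ((h1.add_strictConvexOn h3).add_convexOn h2).congr fun t _ => ?_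
  simp only [energy, Pi.add_apply, Finset.sum_add_distrib]

/-- Join two solutions by a segment in logarithmic coordinates, which stays in the ordered cone. The
energy has zero derivative at both ends, so strict convexity makes its secant slope both positive
and negative. -/
lemma eq_of_residual_eq_zero (hl : 2 ≤ ℓ) (hm₀ : 0 ≤ m₀) (hm : ∀ i, 0 < m i) (hlam : lam < 0)
    {r s : Fin n → ℝ} (hr : r ∈ radii n) (hs : s ∈ radii n)
    (hr0 : ∀ i, residual ℓ m₀ m lam r i = 0) (hs0 : ∀ i, residual ℓ m₀ m lam s i = 0) : r = s := by
  by_contra hne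
  let a : Fin n → ℝ := fun i => Real.log (r i)
  let a' : Fin n → ℝ := fun i => Real.log (s i) - Real.log (r i)
  let c : ℝ → Fin n → ℝ := fun t i => Real.exp (a i + t * a' i)
  have ha : a' ≠ 0 := fun h0 => hne <| funext fun i => by
    have h1 : Real.log (s i) - Real.log (r i) = 0 := congrFun h0 i
    exact (Real.log_injOn_pos (hs.1 i) (hr.1 i) (sub_eq_zero.1 h1)).symm
  have hc0 : c 0 = r := by ext i; simp [c, a, Real.exp_log (hr.1 i)]
  have hc1 : c 1 = s := by ext i; simp [c, a, a', Real.exp_log (hs.1 i)]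
  have hmono : ∀ t ∈ Set.Icc (0 : ℝ) 1, StrictMono fun i => a i + t * a' i := by
    intro t ht i j hij
    have h1 := Real.log_lt_log (hr.1 i) (hr.2 hij)
    have h2 := Real.log_lt_log (hs.1 i) (hs.2 hij)
    simp only [a, a']
    rcases ht.1.eq_or_lt with h0 | h0
    · rw [← h0]; linarith
    · nlinarith [mul_lt_mul_of_pos_left h2 h0, mul_le_mul_of_nonneg_left h1.le (sub_nonneg.2 ht.2)]
  have hconv := strictConvexOn_energy_exp (m₀ := m₀) hl hm₀ hm hlam (convex_Icc 0 1) hmono ha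
  have hd : ∀ t i, HasDerivAt (fun t => c t i) (c t i * a' i) t := fun t i => by
    simpa using (((hasDerivAt_id t).mul_const (a' i)).const_add (a i)).exp
  have hd0 := hasDerivAt_energy ℓ m₀ m lam (hd 0) (by rwa [hc0])
  have hd1 := hasDerivAt_energy ℓ m₀ m lam (hd 1) (by rwa [hc1])
  simp only [hc0, hr0, mul_zero, Finset.sum_const_zero] at hd0
  simp only [hc1, hs0, mul_zero, Finset.sum_const_zero] at hd1
  have l1 := hconv.lt_slope_of_hasDerivAt (Set.left_mem_Icc.2 zero_le_one)
    (Set.right_mem_Icc.2 zero_le_one) one_pos hd0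
  have l2 := hconv.slope_lt_of_hasDerivAt (Set.left_mem_Icc.2 zero_le_one)
    (Set.right_mem_Icc.2 zero_le_one) one_pos hd1
  exact lt_asymm l1 l2

end Uniqueness

/-- For every number of half-lines and all masses there is exactly one central spiderweb
configuration with a given negative constant. -/
theorem existsUnique_isCentralSpiderweb {n ℓ : ℕ} {m₀ : ℝ} {m : Fin n → ℝ} {lam : ℝ}
    (hl : 2 ≤ ℓ) (hm₀ : 0 ≤ m₀) (hm : ∀ i, 0 < m i) (hlam : lam < 0) :
    ∃! r : Fin n → ℝ, r ∈ radii n ∧ IsCentralSpiderweb ℓ m₀ m lam r := by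
  obtain ⟨r, hr, hmin⟩ := exists_isMinOn_energy (n := n) (m := m) hl hm₀ hm hlam
  have h0 := residual_eq_zero_of_isMinOn hm hr hmin
  refine ⟨r, ⟨hr, (isCentralSpiderweb_iff hl m₀ lam m r hr).2 h0⟩, ?_⟩
  rintro s ⟨hs, hsc⟩
  exact eq_of_residual_eq_zero hl hm₀ hm hlam hs hr
    ((isCentralSpiderweb_iff hl m₀ lam m s hs).1 hsc) h0

end Spiderweb

end

theorem mainTheorem1 (n ℓ : ℕ) (m₀ : ℝ) (m : Fin n → ℝ) (lam : ℝ)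
    (hm₀ : 0 ≤ m₀) (hm : ∀ i, 0 < m i) (hlam : lam < 0) :
    (2 ≤ ℓ ∧ ℓ ≤ 9 →
      ∃! r : Fin n → ℝ, r ∈ Spiderweb.radii n ∧ Spiderweb.IsCentralSpiderweb ℓ m₀ m lam r) ∧
    (Antitone m →
      ((ℓ = 10 ∧ n ≤ 17) ∨ (ℓ = 11 ∧ n ≤ 9) ∨ (ℓ = 12 ∧ n ≤ 6) ∨ (ℓ = 13 ∧ n ≤ 5) ∨
        ((ℓ = 14 ∨ ℓ = 15) ∧ n ≤ 4) ∨ ((ℓ = 16 ∨ ℓ = 17 ∨ ℓ = 18) ∧ n ≤ 3)) →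
      ∃! r : Fin n → ℝ, r ∈ Spiderweb.radii n ∧ Spiderweb.IsCentralSpiderweb ℓ m₀ m lam r) :=
  ⟨fun h => Spiderweb.existsUnique_isCentralSpiderweb h.1 hm₀ hm hlam,
    -- Every listed `ℓ` is at least 2, where the convexity argument applies.
    fun _ h => Spiderweb.existsUnique_isCentralSpiderweb (by omega) hm₀ hm hlam⟩
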